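/- Let $G$ be a compact Hausdorff group with normalized Haar measure $\mu$, let $\mathcal{H}$ be a finite-dimensional complex Hilbert space, and let $u$ be a (continuous) unitary projective representation of $G$ on $\mathcal{H}$: unitaries $u(g)$ with $u(g)u(h)\in\mathbb{T}\,u(gh)$ for all $g,h\in G$, such that $g\mapsto u(g)^*xu(g)$ is continuous for every $x\in\mathcal{B}(\mathcal{H})$. Let $N_{fix}=u(G)'=\{x\in\mathcal{B}(\mathcal{H}) : x\,u(g)=u(g)\,x \text{ for all } g\in G\}$, let $k:G\to[0,\infty)$ be measurable with $\int_G k\,d\mu=1$, and put $$\Phi_k(\rho)=\int_G k(g)\,u(g)^*\rho\,u(g)\,d\mu(g),\qquad E_{fix}(\rho)=\int_G u(g)^*\rho\,u(g)\,d\mu(g).$$ Write $\|x\|_p=\operatorname{Tr}(|x|^p)^{1/p}$ for $1\le p<\infty$ and $\|\cdot\|_\infty$ for the operator norm. Negative powers of a positive semidefinite operator are taken as generalized inverses (zero on the kernel), and the power with exponent $0$ is the identity. (1) For every positive semidefinite $\sigma\in N_{fix}$ (in particular every state $\sigma\in N_{fix}$), every positive semidefinite $\rho\in\mathcal{B}(\mathcal{H})$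 and all $p,\hat p\in[1,\infty]$ with $\frac1p+\frac1{\hat p}=1$, $$\|\sigma^{-1/2\hat p}\,\Phi_k(\rho)\,\sigma^{-1/2\hat p}\|_p\ \le\ \|k\|_{L_p(\mu)}\ \|\sigma^{-1/2\hat p}\,E_{fix}(\rho)\,\sigma^{-1/2\hat p}\|_p ,$$ as an inequality in $[0,\infty]$, with $\infty\cdot 0=0$. (2) For all states (positive semidefinite operators of trace one) $\rho\in\mathcal{B}(\mathcal{H})$ and $\sigma\in N_{fix}$, $$D(\Phi_k(\rho)\|\sigma)\ \le\ D(E_{fix}(\rho)\|\sigma)+\int_G k\log k\,d\mu$$ in $(-\infty,+\infty]$, where $D(\rho\|\sigma)=\operatorname{Tr}\,\rho(\log\rho-\log\sigma)$ if $\ker\sigma\subseteq\ker\rho$ and $D(\rho\|\sigma)=+\infty$ otherwise, and where the last integral is $+\infty$ if $k\log k$ is not integrable. -/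

import Mathlib

open MeasureTheory
open scoped ENNReal

noncomputable section

namespace Transference

variable {G : Type*} {H : Type*} [NormedAddCommGroup H] [InnerProductSpace ℂ H] [CompleteSpace H]

/-- A (continuous, unitary) projective representation of a topological group `G` on a Hilbert space
`H`: unitaries `u g` with `u g * u h` equal to `u (g * h)` up to a phase, such that the induced
action `g ↦ u(g)^* x u(g)` on operators is continuous. The lift `u` itself is not required to be
continuous, since a continuous lift need not exist. -/
structure IsProjectiveRep [Group G] [TopologicalSpace G] (u : G → unitary (H →L[ℂ] H)) : Prop where
  mul_phase : ∀ g h : G, ∃ c : ℂ, ‖c‖ = 1 ∧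
    (u g : H →L[ℂ] H) * (u h : H →L[ℂ] H) = c • (u (g * h) : H →L[ℂ] H)
  continuous_conj : ∀ x : H →L[ℂ] H,
    Continuous fun g : G => star (u g : H →L[ℂ] H) * x * (u g : H →L[ℂ] H)

/-- The fixed-point algebra `u(G)'`, the commutant of the operators `u g`. -/
def fixedAlgebra (u : G → unitary (H →L[ℂ] H)) : Subalgebra ℂ (H →L[ℂ] H) :=
  Subalgebra.centralizer ℂ (Set.range fun g : G => (u g : H →L[ℂ] H))

/-- `Φ_k(ρ) = ∫ k(g) u(g)^* ρ u(g) dμ(g)`. -/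
def transferMap [MeasurableSpace G] (μ : Measure G) (u : G → unitary (H →L[ℂ] H)) (k : G → ℝ)
    (ρ : H →L[ℂ] H) : H →L[ℂ] H :=
  ∫ g, (k g : ℂ) • (star (u g : H →L[ℂ] H) * ρ * (u g : H →L[ℂ] H)) ∂μ

/-- `E_fix(ρ) = ∫ u(g)^* ρ u(g) dμ(g)`, the conditional expectation onto the commutant of `u(G)`. -/
def fixExpectation [MeasurableSpace G] (μ : Measure G) (u : G → unitary (H →L[ℂ] H))
    (ρ : H →L[ℂ] H) : H →L[ℂ] H :=
  ∫ g, star (u g : H →L[ℂ] H) * ρ * (u g : H →L[ℂ] H) ∂μ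

/-- The trace of an operator (used on a finite-dimensional space). -/
def opTrace (x : H →L[ℂ] H) : ℂ := LinearMap.trace ℂ H (x : H →ₗ[ℂ] H)

/-- A density operator: positive semidefinite with trace one. -/
def IsState (ρ : H →L[ℂ] H) : Prop := 0 ≤ ρ ∧ opTrace ρ = 1

/-- The Schatten norm `(Tr |x|^p)^{1/p}` for `1 ≤ p < ∞`, and the operator norm for `p = ∞`. -/
def schattenNorm (p : ℝ≥0∞) (x : H →L[ℂ] H) : ℝ :=
  if p = ∞ then ‖x‖ else (opTrace (CFC.abs x ^ p.toReal)).re ^ (1 / p.toReal)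

/-- `σ^{-1/(2q)} x σ^{-1/(2q)}`, with `1/∞ = 0`. For negative exponents the power of a positive
semidefinite `σ` from the functional calculus is the generalized inverse: it is zero on the kernel
of `σ`, and the usual power on the support of `σ`. -/
def weighted (q : ℝ≥0∞) (σ x : H →L[ℂ] H) : H →L[ℂ] H :=
  σ ^ (-(q⁻¹.toReal / 2)) * x * σ ^ (-(q⁻¹.toReal / 2))

open Classical in
/-- The (Umegaki) relative entropy `Tr ρ (log ρ - log σ)`, equal to `+∞` unless the support of `ρ`
is contained in that of `σ` (that is, `ker σ ⊆ ker ρ`). Here `log` is the functional calculus with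
`log 0 = 0`, so that kernels contribute nothing. -/
def relEntropy (ρ σ : H →L[ℂ] H) : EReal :=
  if (σ : H →ₗ[ℂ] H).ker ≤ (ρ : H →ₗ[ℂ] H).ker then
    (((opTrace (ρ * (CFC.log ρ - CFC.log σ))).re : ℝ) : EReal)
  else ⊤

open Classical in
/-- `∫ k log k dμ` for a nonnegative function `k` on a probability space, as an element of
`(-∞, +∞]`: since `t log t` is bounded below, the integral is `+∞` when it is not finite. -/
def entropyIntegral [MeasurableSpace G] (μ : Measure G) (k : G → ℝ) : EReal :=
  if Integrable (fun g => k g * Real.log (k g)) μ then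
    ((∫ g, k g * Real.log (k g) ∂μ : ℝ) : EReal)
  else ⊤

end Transference

end

/-!
The orbit of `ρ` satisfies `∫ u(g)^* ρ u(g) dμ(g) ≤ e ^ L` with `L = log E_fix(ρ)`. For positive
`X_i` with `∑ X_i ≤ e ^ L` and weights `c_i ≥ 0`, the analytic family `e ^ (w L) X_i e ^ (w L)` has
column sums at most one on `Re w = -1/2` and row sums at most `Tr (X_i e ^ ((p - 1) L))` on
`Re w = (p - 1) / 2`, so the three-lines theorem, evaluated at `w = 0`, gives
`Tr (∑ c_i X_i) ^ p ≤ ∑ c_i ^ p Tr (X_i e ^ ((p - 1) L))`.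
The weights enter only through `c_i ^ p`, so the bound passes from sums to integrals. For the orbit
of `ρ` the operator `e ^ ((p - 1) L)` commutes with `u`, and the right-hand side becomes
`(∫ k ^ p) Tr E_fix(ρ) ^ p`. The weight `σ` commutes with `u` too and can be absorbed into `ρ`. At
`p = 1` both sides of the inequality agree, so that differentiating there gives the entropy bound.
-/

noncomputable section

namespace Transference

section Interpolation

open Complex Filter Asymptotics Complex.HadamardThreeLines

/-- The complex power `t ^ z` of `t ≥ 0`, with the value `0` at `t = 0` for every exponent `z`, so
that it is an entire function of `z`. -/
def supportCpow (t : ℝ) (z : ℂ) : ℂ := if t = 0 then 0 else (t : ℂ) ^ z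

theorem differentiable_supportCpow (t : ℝ) : Differentiable ℂ (supportCpow t) := by
  unfold supportCpow
  split_ifs with ht
  · exact differentiable_const 0
  · exact fun z => differentiableAt_id.const_cpow (.inl (ofReal_ne_zero.2 ht))

theorem norm_supportCpow_le {t : ℝ} (ht : 0 ≤ t) (z : ℂ) : ‖supportCpow t z‖ ≤ t ^ z.re := by
  rcases ht.eq_or_lt with rfl | ht
  · simpa [supportCpow] using Real.zero_rpow_nonneg _
  · rw [supportCpow, if_neg ht.ne', norm_cpow_eq_rpow_re_of_pos ht]

theorem supportCpow_ofReal {t s : ℝ} (ht : 0 ≤ t) (hs : s ≠ 0) :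
    supportCpow t s = (t ^ s : ℝ) := by
  rcases ht.eq_or_lt with rfl | ht
  · simp [supportCpow, Real.zero_rpow hs]
  · rw [supportCpow, if_neg ht.ne', ofReal_cpow ht.le]

theorem supportCpow_isBigO_one {t : ℝ} (ht : 0 ≤ t) :
    supportCpow t =O[𝓟 (verticalClosedStrip 0 1)] fun _ => (1 : ℝ) := by
  refine .of_bound (max 1 t) (eventually_principal.2 fun z hz => ?_)
  rw [norm_one, mul_one]
  refine (norm_supportCpow_le ht z).trans ?_
  rcases le_total t 1 with h | h
  · exact (Real.rpow_le_one ht h hz.1).trans (le_max_left _ _)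
  · exact (Real.rpow_le_self_of_one_le h hz.2).trans (le_max_right _ _)

theorem norm_le_rpow_mul_rpow_of_isBigO_one {F : ℂ → ℂ} (hF : Differentiable ℂ F)
    (hbdd : F =O[𝓟 (verticalClosedStrip 0 1)] fun _ => (1 : ℝ)) {a b : ℝ}
    (ha : ∀ z : ℂ, z.re = 0 → ‖F z‖ ≤ a) (hb : ∀ z : ℂ, z.re = 1 → ‖F z‖ ≤ b) {s : ℝ}
    (hs : s ∈ Set.Icc (0 : ℝ) 1) : ‖F s‖ ≤ a ^ (1 - s) * b ^ s := by
  obtain ⟨C, hC⟩ := isBigO_principal.1 hbdd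
  simpa using norm_le_interp_of_mem_verticalClosedStrip₀₁' F (z := s)
    (by simpa [verticalClosedStrip] using hs) hF.diffContOnCl
    ⟨C, by rintro _ ⟨z, hz, rfl⟩; simpa using hC z hz⟩ ha hb

/-- Stein interpolation between `ℓ¹ → ℓ¹` and `ℓ^∞ → ℓ^∞` for an analytic family of kernels. -/
theorem norm_sum_sum_rpow_mul_le {ι κ : Type*} {s : Finset ι} {t : Finset κ} {h : ι → κ → ℂ → ℂ}
    (hdiff : ∀ i ∈ s, ∀ j ∈ t, Differentiable ℂ (h i j))
    (hbdd : ∀ i ∈ s, ∀ j ∈ t, h i j =O[𝓟 (verticalClosedStrip 0 1)] fun _ => (1 : ℝ))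
    {α : κ → ℝ} (hα : ∀ j ∈ t, 0 ≤ α j) {γ : ι → ℝ} (hγ : ∀ i ∈ s, 0 ≤ γ i) {w : ι → ℝ}
    (h0 : ∀ z : ℂ, z.re = 0 → ∀ j ∈ t, ∑ i ∈ s, ‖h i j z‖ ≤ 1)
    (h1 : ∀ z : ℂ, z.re = 1 → ∀ i ∈ s, ∑ j ∈ t, ‖h i j z‖ ≤ w i)
    {θ : ℝ} (hθ : θ ∈ Set.Ioo (0 : ℝ) 1) :
    ‖∑ i ∈ s, ∑ j ∈ t, ((γ i ^ θ * α j ^ (1 - θ) : ℝ) : ℂ) * h i j θ‖ ≤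
      (∑ j ∈ t, α j) ^ (1 - θ) * (∑ i ∈ s, γ i * w i) ^ θ := by
  let F : ℂ → ℂ := fun z =>
    ∑ i ∈ s, ∑ j ∈ t, supportCpow (γ i) z * supportCpow (α j) (1 - z) * h i j z
  have hF : Differentiable ℂ F := .fun_sum fun i hi => .fun_sum fun j hj =>
    ((differentiable_supportCpow _).mul ((differentiable_supportCpow _).comp (by fun_prop))).mul
      (hdiff i hi j hj)
  have hreflect : Tendsto (fun z : ℂ => 1 - z) (𝓟 (verticalClosedStrip 0 1))
      (𝓟 (verticalClosedStrip 0 1)) :=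
    tendsto_principal_principal.2 fun z hz =>
      ⟨by simpa using hz.2, by simpa using hz.1⟩
  have hFbdd : F =O[𝓟 (verticalClosedStrip 0 1)] fun _ => (1 : ℝ) :=
    .fun_sum fun i hi => .fun_sum fun j hj => by
      simpa only [mul_one, Function.comp_def] using ((supportCpow_isBigO_one (hγ i hi)).mul
        ((supportCpow_isBigO_one (hα j hj)).comp_tendsto hreflect)).mul (hbdd i hi j hj)
  have hnorm : ∀ z, ‖F z‖ ≤
      ∑ i ∈ s, ∑ j ∈ t, γ i ^ z.re * α j ^ (1 - z.re) * ‖h i j z‖ := fun z =>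
    norm_sum_le_of_le _ fun i hi => norm_sum_le_of_le _ fun j hj => by
      rw [norm_mul, norm_mul]
      have hγz := norm_supportCpow_le (hγ i hi) z
      have hαz : ‖supportCpow (α j) (1 - z)‖ ≤ α j ^ (1 - z.re) := by
        simpa using norm_supportCpow_le (hα j hj) (1 - z)
      have := Real.rpow_nonneg (hγ i hi) z.re
      gcongr
  have hF0 : ∀ z : ℂ, z.re = 0 → ‖F z‖ ≤ ∑ j ∈ t, α j := fun z hz => by
    refine (hnorm z).trans ?_
    simp only [hz, Real.rpow_zero, one_mul, sub_zero, Real.rpow_one]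
    rw [Finset.sum_comm]
    simp only [← Finset.mul_sum]
    exact Finset.sum_le_sum fun j hj => mul_le_of_le_one_right (hα j hj) (h0 z hz j hj)
  have hF1 : ∀ z : ℂ, z.re = 1 → ‖F z‖ ≤ ∑ i ∈ s, γ i * w i := fun z hz => by
    refine (hnorm z).trans ?_
    simp only [hz, Real.rpow_zero, sub_self, Real.rpow_one, mul_one, ← Finset.mul_sum]
    exact Finset.sum_le_sum fun i hi => mul_le_mul_of_nonneg_left (h1 z hz i hi) (hγ i hi)
  have hFθ : F θ = ∑ i ∈ s, ∑ j ∈ t, ((γ i ^ θ * α j ^ (1 - θ) : ℝ) : ℂ) * h i j θ :=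
    Finset.sum_congr rfl fun i hi => Finset.sum_congr rfl fun j hj => by
      rw [← ofReal_one, ← ofReal_sub, supportCpow_ofReal (hγ i hi) hθ.1.ne',
        supportCpow_ofReal (hα j hj) (sub_pos.2 hθ.2).ne', ofReal_mul]
  exact hFθ ▸ norm_le_rpow_mul_rpow_of_isBigO_one hF hFbdd hF0 hF1 ⟨hθ.1.le, hθ.2.le⟩

end Interpolation

section Operators

open Filter Complex.HadamardThreeLines
open scoped InnerProductSpace

section Exponential

variable {A : Type*} [NormedRing A] [NormedAlgebra ℂ A]

/-- The operator `e^{wL} X e^{wL}`, an analytic family in `w` passing through `X` at `w = 0`. It is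
`E^w X E^w` for `E = e^L`. -/
def expSandwich (L X : A) (w : ℂ) : A := NormedSpace.exp (w • L) * X * NormedSpace.exp (w • L)

theorem expSandwich_zero (L X : A) : expSandwich L X 0 = X := by
  simp [expSandwich]

theorem differentiable_expSandwich [CompleteSpace A] (L X : A) :
    Differentiable ℂ (expSandwich L X) :=
  have hexp : Differentiable ℂ fun w : ℂ => NormedSpace.exp (w • L) := fun w =>
    (hasDerivAt_exp_smul_const L w).differentiableAt
  (hexp.mul_const X).mul hexp

variable [StarRing A] [ContinuousStar A] [StarModule ℂ A] {L : A}

theorem star_exp_smul (hL : IsSelfAdjoint L) (w : ℂ) :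
    star (NormedSpace.exp (w • L)) = NormedSpace.exp (star w • L) := by
  rw [NormedSpace.star_exp, star_smul, hL.star_eq]

theorem star_exp_smul_mul_exp_smul_mul_exp_smul [CompleteSpace A] (hL : IsSelfAdjoint L)
    (w : ℂ) (r : ℝ) :
    star (NormedSpace.exp (w • L)) * NormedSpace.exp (r • L) * NormedSpace.exp (w • L) =
      NormedSpace.exp ((2 * w.re + r) • L) := by
  let +nondep : NormedAlgebra ℚ A := .restrictScalars ℚ ℂ A
  have hcomm : ∀ a b : ℂ, Commute (a • L) (b • L) := fun a b =>
    ((Commute.refl L).smul_left a).smul_right b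
  rw [star_exp_smul hL, ← Complex.coe_smul r,
    ← NormedSpace.exp_add_of_commute (hcomm _ _), ← add_smul,
    ← NormedSpace.exp_add_of_commute (hcomm _ _), ← add_smul, add_right_comm, add_comm (star w),
    RCLike.star_def, Complex.add_conj, ← Complex.ofReal_add, Complex.coe_smul]

theorem norm_expSandwich_le [CompleteSpace A] [CStarRing A] (hL : IsSelfAdjoint L) (X : A) (w : ℂ) :
    ‖expSandwich L X w‖ ≤ ‖X‖ * ‖NormedSpace.exp ((2 * w.re) • L)‖ := by
  have hstar : star (NormedSpace.exp (w • L)) * NormedSpace.exp (w • L) =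
      NormedSpace.exp ((2 * w.re) • L) := by
    simpa using star_exp_smul_mul_exp_smul_mul_exp_smul hL w 0
  calc ‖expSandwich L X w‖
      ≤ ‖NormedSpace.exp (w • L)‖ * ‖X‖ * ‖NormedSpace.exp (w • L)‖ :=
        (norm_mul_le _ _).trans (mul_le_mul_of_nonneg_right (norm_mul_le _ _) (norm_nonneg _))
    _ = ‖X‖ * ‖NormedSpace.exp ((2 * w.re) • L)‖ := by
        rw [← hstar, CStarRing.norm_star_mul_self]; ring

theorem expSandwich_isBigO_one [CompleteSpace A] [CStarRing A] (hL : IsSelfAdjoint L) (X : A)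
    (p : ℝ) :
    (fun z : ℂ => expSandwich L X ((p * z - 1) / 2)) =O[𝓟 (verticalClosedStrip 0 1)]
      fun _ => (1 : ℝ) := by
  let +nondep : NormedAlgebra ℚ A := .restrictScalars ℚ ℂ A
  have hcont : Continuous fun x : ℝ => NormedSpace.exp ((p * x - 1) • L) :=
    NormedSpace.exp_continuous.comp (by fun_prop)
  obtain ⟨C, hC⟩ := (isCompact_Icc (a := (0 : ℝ)) (b := 1)).exists_bound_of_continuousOn
    hcont.continuousOn
  refine .of_bound (‖X‖ * C) (eventually_principal.2 fun z hz => ?_)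
  have hre : 2 * ((p * z - 1) / 2 : ℂ).re = p * z.re - 1 := by
    simp [mul_div_cancel₀]
  rw [norm_one, mul_one]
  refine (norm_expSandwich_le hL X _).trans (mul_le_mul_of_nonneg_left ?_ (norm_nonneg X))
  rw [hre]
  exact hC z.re hz

end Exponential

variable {H : Type*} [NormedAddCommGroup H] [InnerProductSpace ℂ H]

theorem opTrace_mul_comm (x y : H →L[ℂ] H) : opTrace (x * y) = opTrace (y * x) :=
  LinearMap.trace_mul_comm ℂ (x : H →ₗ[ℂ] H) (y : H →ₗ[ℂ] H)

theorem opTrace_eq_sum_inner {ι : Type*} [Fintype ι] (b : OrthonormalBasis ι ℂ H) (x : H →L[ℂ] H) :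
    opTrace x = ∑ i, ⟪b i, x (b i)⟫_ℂ :=
  LinearMap.trace_eq_sum_inner _ b

/-- The bounded real functional `x ↦ Re Tr (x y)` on the operators of a finite-dimensional space. -/
def reTraceMul [FiniteDimensional ℂ H] (y : H →L[ℂ] H) : (H →L[ℂ] H) →L[ℝ] ℝ :=
  Complex.reCLM ∘L (LinearMap.toContinuousLinearMap (LinearMap.trace ℂ H ∘ₗ
    ContinuousLinearMap.coeLM ℂ ∘ₗ LinearMap.mulRight ℂ y)).restrictScalars ℝ

theorem reTraceMul_apply [FiniteDimensional ℂ H] (y x : H →L[ℂ] H) :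
    reTraceMul y x = (opTrace (x * y)).re :=
  rfl

theorem reTraceMul_one [FiniteDimensional ℂ H] (x : H →L[ℂ] H) :
    reTraceMul 1 x = (opTrace x).re := by
  rw [reTraceMul_apply, mul_one]

theorem re_inner_apply_mono {X Y : H →L[ℂ] H} (h : X ≤ Y) (v : H) :
    (⟪v, X v⟫_ℂ).re ≤ (⟪v, Y v⟫_ℂ).re := by
  have := ((ContinuousLinearMap.le_def _ _).1 h).re_inner_nonneg_right v
  simpa [inner_sub_right] using this

theorem continuousOn_spectrum_real [FiniteDimensional ℂ H] (A : H →L[ℂ] H) (f : ℝ → ℝ) :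
    ContinuousOn f (spectrum ℝ A) := by
  have h : (spectrum ℂ A).Finite :=
    AlgEquiv.spectrum_eq (Module.End.toContinuousLinearMap H) (A : H →ₗ[ℂ] H) ▸
      Module.End.finite_spectrum (A : H →ₗ[ℂ] H)
  have hreal : (spectrum ℝ A).Finite := by
    simpa only [spectrum.preimage_algebraMap] using
      h.preimage (FaithfulSMul.algebraMap_injective ℝ ℂ).injOn
  exact hreal.continuousOn f

theorem exists_orthonormalBasis_apply_eq_smul [FiniteDimensional ℂ H] {A : H →L[ℂ] H}
    (hA : 0 ≤ A) :
    ∃ (b : OrthonormalBasis (Fin (Module.finrank ℂ H)) ℂ H) (a : Fin (Module.finrank ℂ H) → ℝ),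
      (∀ i, 0 ≤ a i) ∧ ∀ i, A (b i) = (a i : ℂ) • b i := by
  have hpos := (ContinuousLinearMap.nonneg_iff_isPositive A).1 hA
  exact ⟨hpos.isSymmetric.eigenvectorBasis rfl, hpos.isSymmetric.eigenvalues rfl,
    hpos.toLinearMap.nonneg_eigenvalues rfl, hpos.isSymmetric.apply_eigenvectorBasis rfl⟩

theorem re_opTrace_nonneg [FiniteDimensional ℂ H] {A : H →L[ℂ] H} (hA : 0 ≤ A) :
    0 ≤ (opTrace A).re :=
  have hpos := (ContinuousLinearMap.nonneg_iff_isPositive A).1 hA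
  (Complex.nonneg_iff.1 hpos.toLinearMap.trace_nonneg).1

theorem eq_zero_of_re_opTrace_eq_zero [FiniteDimensional ℂ H] {A : H →L[ℂ] H} (hA : 0 ≤ A)
    (h : (opTrace A).re = 0) : A = 0 := by
  have hpos := ((ContinuousLinearMap.nonneg_iff_isPositive A).1 hA).toLinearMap
  let b := stdOrthonormalBasis ℂ H
  have hM := (LinearMap.posSemidef_toMatrix_iff b).2 hpos
  have htr : opTrace A = 0 := Complex.ext h (Complex.nonneg_iff.1 hpos.trace_nonneg).2.symm
  rw [opTrace, LinearMap.trace_eq_matrix_trace ℂ b.toBasis, hM.trace_eq_zero_iff] at htr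
  exact ContinuousLinearMap.coe_injective ((LinearMap.toMatrix _ _).map_eq_zero_iff.1 htr)

variable [CompleteSpace H]

theorem inner_star_mul_self_apply (S : H →L[ℂ] H) (x y : H) :
    ⟪x, (star S * S) y⟫_ℂ = ⟪S x, S y⟫_ℂ := by
  rw [mul_apply_eq_comp, ContinuousLinearMap.star_eq_adjoint,
    ContinuousLinearMap.adjoint_inner_right]

theorem norm_inner_apply_le_half_add {X : H →L[ℂ] H} (hX : 0 ≤ X) (x y : H) :
    ‖⟪x, X y⟫_ℂ‖ ≤ ((⟪x, X x⟫_ℂ).re + (⟪y, X y⟫_ℂ).re) / 2 := by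
  obtain ⟨S, rfl⟩ := CStarAlgebra.nonneg_iff_eq_star_mul_self.1 hX
  have hs : ∀ x : H, (⟪S x, S x⟫_ℂ).re = ‖S x‖ ^ 2 := fun x =>
    inner_self_eq_norm_sq (𝕜 := ℂ) (S x)
  simp only [inner_star_mul_self_apply, hs]
  nlinarith [norm_inner_le_norm (𝕜 := ℂ) (S x) (S y), sq_nonneg (‖S x‖ - ‖S y‖)]

theorem apply_eq_zero_of_re_inner_eq_zero {X : H →L[ℂ] H} (hX : 0 ≤ X) {v : H}
    (hv : (⟪v, X v⟫_ℂ).re = 0) : X v = 0 := by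
  obtain ⟨S, rfl⟩ := CStarAlgebra.nonneg_iff_eq_star_mul_self.1 hX
  rw [inner_star_mul_self_apply] at hv
  have hSv : ‖S v‖ ^ 2 = 0 := (inner_self_eq_norm_sq (𝕜 := ℂ) (S v)).symm.trans hv
  rw [mul_apply_eq_comp, norm_eq_zero.1 (pow_eq_zero_iff two_ne_zero |>.1 hSv), map_zero]

theorem norm_inner_mul_mul_le {X : H →L[ℂ] H} (hX : 0 ≤ X) (T : H →L[ℂ] H) (v : H) :
    ‖⟪v, (T * X * T) v⟫_ℂ‖ ≤
      ((⟪v, (T * X * star T) v⟫_ℂ).re + (⟪v, (star T * X * T) v⟫_ℂ).re) / 2 := by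
  simpa only [mul_apply_eq_comp, ContinuousLinearMap.star_eq_adjoint,
    ContinuousLinearMap.adjoint_inner_left, ContinuousLinearMap.adjoint_inner_right] using
    norm_inner_apply_le_half_add hX (star T v) (T v)

theorem sum_norm_inner_expSandwich_le_one {ι : Type*} {s : Finset ι} {X : ι → H →L[ℂ] H}
    (hX : ∀ i ∈ s, 0 ≤ X i) {L : H →L[ℂ] H} (hL : IsSelfAdjoint L)
    (hXL : ∑ i ∈ s, X i ≤ NormedSpace.exp L) {w : ℂ} (hw : 2 * w.re = -1) {v : H} (hv : ‖v‖ = 1) :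
    ∑ i ∈ s, ‖⟪v, expSandwich L (X i) w v⟫_ℂ‖ ≤ 1 := by
  have hsum : ∀ S T : H →L[ℂ] H, ∑ i ∈ s, (⟪v, (S * X i * T) v⟫_ℂ).re =
      (⟪v, (S * (∑ i ∈ s, X i) * T) v⟫_ℂ).re := fun S T => by
    simp [Finset.mul_sum, Finset.sum_mul]
  have hhalf : ∀ w : ℂ, 2 * w.re = -1 → (⟪v, (star (NormedSpace.exp (w • L)) * (∑ i ∈ s, X i) *
      NormedSpace.exp (w • L)) v⟫_ℂ).re ≤ 1 := fun w hw => by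
    have hone := star_exp_smul_mul_exp_smul_mul_exp_smul hL w 1
    rw [one_smul, hw, neg_add_cancel, zero_smul, NormedSpace.exp_zero] at hone
    refine (re_inner_apply_mono (star_left_conjugate_le_conjugate hXL _) v).trans_eq ?_
    rw [hone, one_apply_eq_self, inner_self_eq_norm_sq_to_K, hv]
    simp
  calc ∑ i ∈ s, ‖⟪v, expSandwich L (X i) w v⟫_ℂ‖
      ≤ ∑ i ∈ s, ((⟪v, (NormedSpace.exp (w • L) * X i * star (NormedSpace.exp (w • L))) v⟫_ℂ).re +
          (⟪v, (star (NormedSpace.exp (w • L)) * X i * NormedSpace.exp (w • L)) v⟫_ℂ).re) / 2 :=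
        Finset.sum_le_sum fun i hi => norm_inner_mul_mul_le (hX i hi) _ v
    _ ≤ (1 + 1) / 2 := by
        rw [← Finset.sum_div, Finset.sum_add_distrib, hsum, hsum]
        have hw' := hhalf (star w) (by simpa using hw)
        rw [← star_exp_smul hL, star_star] at hw'
        linarith [hhalf w hw]
    _ = 1 := by norm_num

theorem sum_norm_inner_expSandwich_le_opTrace {ι : Type*} [Fintype ι]
    (b : OrthonormalBasis ι ℂ H) {X : H →L[ℂ] H} (hX : 0 ≤ X) {L : H →L[ℂ] H}
    (hL : IsSelfAdjoint L) (w : ℂ) :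
    ∑ i, ‖⟪b i, expSandwich L X w (b i)⟫_ℂ‖ ≤
      (opTrace (X * NormedSpace.exp ((2 * w.re) • L))).re := by
  set T := NormedSpace.exp (w • L)
  have htrace : ∀ S T : H →L[ℂ] H, ∑ i, (⟪b i, (S * X * T) (b i)⟫_ℂ).re =
      (opTrace (X * (T * S))).re := fun S T => by
    rw [← Complex.re_sum, ← opTrace_eq_sum_inner, mul_assoc, opTrace_mul_comm, mul_assoc]
  have hstar : star T * T = NormedSpace.exp ((2 * w.re) • L) := by
    simpa using star_exp_smul_mul_exp_smul_mul_exp_smul hL w 0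
  have hstar' : T * star T = NormedSpace.exp ((2 * w.re) • L) := by
    have h := star_exp_smul_mul_exp_smul_mul_exp_smul hL (star w) 0
    rw [← star_exp_smul hL, star_star] at h
    simpa using h
  calc ∑ i, ‖⟪b i, expSandwich L X w (b i)⟫_ℂ‖
      ≤ ∑ i, ((⟪b i, (T * X * star T) (b i)⟫_ℂ).re + (⟪b i, (star T * X * T) (b i)⟫_ℂ).re) / 2 :=
        Finset.sum_le_sum fun i _ => norm_inner_mul_mul_le hX T (b i)
    _ = (opTrace (X * NormedSpace.exp ((2 * w.re) • L))).re := by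
        rw [← Finset.sum_div, Finset.sum_add_distrib, htrace, htrace, hstar, hstar',
          add_self_div_two]

theorem re_opTrace_mul_exp_smul_nonneg [FiniteDimensional ℂ H] {X : H →L[ℂ] H} (hX : 0 ≤ X)
    {L : H →L[ℂ] H} (hL : IsSelfAdjoint L) (r : ℝ) :
    0 ≤ (opTrace (X * NormedSpace.exp (r • L))).re := by
  have h := sum_norm_inner_expSandwich_le_opTrace (stdOrthonormalBasis ℂ H) hX hL (r / 2 : ℝ)
  rw [Complex.ofReal_re, mul_div_cancel₀ r two_ne_zero] at h
  exact (Finset.sum_nonneg fun i _ => norm_nonneg _).trans h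

variable [FiniteDimensional ℂ H]

theorem cfc_apply_of_apply_eq_smul {A : H →L[ℂ] H} (hA : IsSelfAdjoint A) (f : ℝ → ℝ) {t : ℝ}
    {v : H} (hv : A v = (t : ℂ) • v) : cfc f A v = (f t : ℂ) • v := by
  have hcont := continuousOn_spectrum_real A
  have hdiv : ∀ x, f x = f t + (f x - f t) / (x - t) * (x - t) := fun x => by
    rcases eq_or_ne x t with rfl | hx
    · simp
    · rw [div_mul_cancel₀ _ (sub_ne_zero.2 hx), add_sub_cancel]
  rw [cfc_congr fun x _ => hdiv x, cfc_const_add _ _ _ (hcont _), cfc_mul _ _ _ (hcont _) (hcont _),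
    cfc_sub _ _ _ (hcont _) (hcont _), cfc_id' ℝ A, cfc_const _ _ ]
  simp [Algebra.algebraMap_eq_smul_one, hv]

theorem opTrace_cfc {ι : Type*} [Fintype ι] {A : H →L[ℂ] H} (hA : IsSelfAdjoint A)
    (b : OrthonormalBasis ι ℂ H) {a : ι → ℝ} (hb : ∀ i, A (b i) = (a i : ℂ) • b i) (f : ℝ → ℝ) :
    opTrace (cfc f A) = ((∑ i, f (a i) : ℝ) : ℂ) := by
  simp [opTrace_eq_sum_inner b, cfc_apply_of_apply_eq_smul hA f (hb _)]

end Operators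

section TraceInequality

open Filter Topology Complex.HadamardThreeLines
open scoped InnerProductSpace

variable {H : Type*} [NormedAddCommGroup H] [InnerProductSpace ℂ H] [CompleteSpace H]
  {ι : Type*} {s : Finset ι} {X : ι → H →L[ℂ] H} {L : H →L[ℂ] H} {c : ι → ℝ} {p : ℝ}

theorem norm_sum_sum_mul_inner_le {κ : Type*} [Fintype κ] (b : OrthonormalBasis κ ℂ H)
    (hX : ∀ i ∈ s, 0 ≤ X i) (hL : IsSelfAdjoint L) (hXL : ∑ i ∈ s, X i ≤ NormedSpace.exp L)
    (hc : ∀ i ∈ s, 0 ≤ c i) {a : κ → ℝ} (ha : ∀ j, 0 ≤ a j) (hp : 1 < p) :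
    ‖∑ i ∈ s, ∑ j, ((c i * a j ^ (p - 1) : ℝ) : ℂ) * ⟪b j, X i (b j)⟫_ℂ‖ ≤
      (∑ j, a j ^ p) ^ (1 - p⁻¹) *
        (∑ i ∈ s, c i ^ p * (opTrace (X i * NormedSpace.exp ((p - 1) • L))).re) ^ p⁻¹ := by
  have hp0 : p ≠ 0 := by positivity
  -- The exponent has real part `-1/2` on `Re z = 0` and `(p - 1) / 2` on `Re z = 1`, and it
  -- vanishes at `z = 1 / p`.
  let h : ι → κ → ℂ → ℂ := fun i j z => ⟪b j, expSandwich L (X i) ((p * z - 1) / 2) (b j)⟫_ℂ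
  let compression : κ → (H →L[ℂ] H) →L[ℂ] ℂ := fun j =>
    (innerSL ℂ (b j)).comp (ContinuousLinearMap.apply ℂ H (b j))
  have hdiff : ∀ i j, Differentiable ℂ (h i j) := fun i j =>
    (compression j).differentiable.comp ((differentiable_expSandwich L (X i)).comp (by fun_prop))
  have hbdd : ∀ i j, h i j =O[𝓟 (verticalClosedStrip 0 1)] fun _ => (1 : ℝ) := fun i j =>
    ((compression j).isBigO_comp _ _).trans (expSandwich_isBigO_one hL (X i) p)
  have hre : ∀ z : ℂ, 2 * ((p * z - 1) / 2 : ℂ).re = p * z.re - 1 := fun z => by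
    simp [mul_div_cancel₀]
  have h0 : ∀ z : ℂ, z.re = 0 → ∀ j, ∑ i ∈ s, ‖h i j z‖ ≤ 1 := fun z hz j =>
    sum_norm_inner_expSandwich_le_one hX hL hXL (by rw [hre, hz]; simp) (b.norm_eq_one j)
  have h1 : ∀ z : ℂ, z.re = 1 → ∀ i ∈ s, ∑ j, ‖h i j z‖ ≤
      (opTrace (X i * NormedSpace.exp ((p - 1) • L))).re := fun z hz i hi => by
    have := sum_norm_inner_expSandwich_le_opTrace b (hX i hi) hL ((p * z - 1) / 2)
    rwa [hre, hz, mul_one] at this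
  have hθ : ∀ i j, h i j (p⁻¹ : ℝ) = ⟪b j, X i (b j)⟫_ℂ := fun i j => by
    simp [h, hp0, expSandwich_zero]
  have hweight : ∀ i ∈ s, ∀ j, c i * a j ^ (p - 1) = (c i ^ p) ^ p⁻¹ * (a j ^ p) ^ (1 - p⁻¹) :=
    fun i hi j => by
      rw [Real.rpow_rpow_inv (hc i hi) hp0, ← Real.rpow_mul (ha j), mul_one_sub,
        mul_inv_cancel₀ hp0]
  refine le_of_eq_of_le (congrArg norm <| Finset.sum_congr rfl fun i hi =>
    Finset.sum_congr rfl fun j _ => by rw [hweight i hi j, ← hθ]) <|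
    norm_sum_sum_rpow_mul_le (fun i _ j _ => hdiff i j) (fun i _ j _ => hbdd i j)
      (fun j _ => Real.rpow_nonneg (ha j) p) (fun i hi => Real.rpow_nonneg (hc i hi) p)
      (fun z hz j _ => h0 z hz j) h1 ⟨by positivity, inv_lt_one_of_one_lt₀ hp⟩

theorem le_of_le_rpow_mul_rpow {S M θ : ℝ} (hS : 0 ≤ S) (hM : 0 ≤ M) (hθ : 0 < θ)
    (h : S ≤ S ^ (1 - θ) * M ^ θ) : S ≤ M := by
  rcases hS.eq_or_lt with rfl | hS
  · exact hM
  rw [Real.rpow_sub hS, Real.rpow_one, div_mul_eq_mul_div, le_div_iff₀ (by positivity),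
    mul_le_mul_iff_right₀ hS] at h
  exact (Real.rpow_le_rpow_iff hS.le hM hθ).1 h

theorem re_opTrace_rpow_sum_smul_le [FiniteDimensional ℂ H] (hX : ∀ i ∈ s, 0 ≤ X i)
    (hL : IsSelfAdjoint L) (hXL : ∑ i ∈ s, X i ≤ NormedSpace.exp L) (hc : ∀ i ∈ s, 0 ≤ c i)
    (hp : 1 ≤ p) :
    (opTrace ((∑ i ∈ s, c i • X i) ^ p)).re ≤
      ∑ i ∈ s, c i ^ p * (opTrace (X i * NormedSpace.exp ((p - 1) • L))).re := by
  have hA : 0 ≤ ∑ i ∈ s, c i • X i := Finset.sum_nonneg fun i hi => smul_nonneg (hc i hi) (hX i hi)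
  rcases hp.eq_or_lt with rfl | hp
  · simp [CFC.rpow_one _ hA, opTrace]
  obtain ⟨b, a, ha, hb⟩ := exists_orthonormalBasis_apply_eq_smul hA
  have htrace : (opTrace ((∑ i ∈ s, c i • X i) ^ p)).re = ∑ j, a j ^ p := by
    rw [CFC.rpow_eq_cfc_real hA, opTrace_cfc hA.isSelfAdjoint b hb, Complex.ofReal_re]
  have hpair : ∑ i ∈ s, ∑ j, ((c i * a j ^ (p - 1) : ℝ) : ℂ) * ⟪b j, X i (b j)⟫_ℂ =
      ((∑ j, a j ^ p : ℝ) : ℂ) := by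
    rw [Finset.sum_comm, Complex.ofReal_sum]
    refine Finset.sum_congr rfl fun j _ => ?_
    have hbj : ∑ i ∈ s, (c i : ℂ) * ⟪b j, X i (b j)⟫_ℂ = a j := by
      have := congrArg (fun v => ⟪b j, v⟫_ℂ) (hb j)
      simpa [inner_sum, inner_smul_right] using this
    have hpow : a j ^ p = a j ^ (p - 1) * a j := by
      rw [← Real.rpow_add_one' (ha j) (by linarith), sub_add_cancel]
    rw [hpow, Complex.ofReal_mul, ← hbj, Finset.mul_sum]
    exact Finset.sum_congr rfl fun i _ => by push_cast; ring
  have hS : 0 ≤ ∑ j, a j ^ p := Finset.sum_nonneg fun j _ => Real.rpow_nonneg (ha j) p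
  have h := norm_sum_sum_mul_inner_le b hX hL hXL hc ha hp
  rw [hpair, Complex.norm_of_nonneg hS] at h
  exact htrace ▸ le_of_le_rpow_mul_rpow hS
    (Finset.sum_nonneg fun i hi => mul_nonneg (Real.rpow_nonneg (hc i hi) p)
      (re_opTrace_mul_exp_smul_nonneg (hX i hi) hL _)) (by positivity) h

theorem hasDerivAt_rpow_exponent {t : ℝ} (ht : 0 ≤ t) :
    HasDerivAt (fun p : ℝ => t ^ p) (t * Real.log t) 1 := by
  rcases ht.eq_or_lt with rfl | ht
  · have hzero : (fun p : ℝ => (0 : ℝ) ^ p) =ᶠ[𝓝 1] fun _ => 0 :=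
      (eventually_ne_nhds one_ne_zero).mono fun p hp => Real.zero_rpow hp
    simpa using (hasDerivAt_const (1 : ℝ) (0 : ℝ)).congr_of_eventuallyEq hzero
  · simpa [mul_comm] using (hasDerivAt_id (1 : ℝ)).const_rpow ht

theorem deriv_le_deriv_of_eq_of_forall_lt_le {f g : ℝ → ℝ} {f' g' a : ℝ} (hf : HasDerivAt f f' a)
    (hg : HasDerivAt g g' a) (heq : f a = g a) (hle : ∀ x, a < x → f x ≤ g x) : f' ≤ g' := by
  have hslope : ∀ {φ : ℝ → ℝ} {φ' : ℝ}, HasDerivAt φ φ' a →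
      Tendsto (slope φ a) (𝓝[>] a) (𝓝 φ') := fun h =>
    (hasDerivAt_iff_tendsto_slope.1 h).mono_left (nhdsWithin_mono a fun x (hx : a < x) => hx.ne')
  refine le_of_tendsto_of_tendsto (hslope hf) (hslope hg) ?_
  filter_upwards [self_mem_nhdsWithin] with x hx
  rw [slope_def_field, slope_def_field, heq]
  exact div_le_div_of_nonneg_right (sub_le_sub_right (hle x hx) _) (sub_pos.2 hx).le

theorem hasDerivAt_re_opTrace_mul_exp_smul [FiniteDimensional ℂ H] (X L : H →L[ℂ] H) :
    HasDerivAt (fun p : ℝ => (opTrace (X * NormedSpace.exp ((p - 1) • L))).re)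
      (opTrace (X * L)).re 1 := by
  have hexp : HasDerivAt (fun p : ℝ => NormedSpace.exp ((p - 1) • L)) L 1 := by
    have := (hasDerivAt_exp_smul_const (𝕂 := ℝ) L (1 - 1)).comp_sub_const 1 1
    simpa using this
  have := (reTraceMul X).hasFDerivAt.comp_hasDerivAt (1 : ℝ) hexp
  simpa only [Function.comp_def, reTraceMul_apply, opTrace_mul_comm _ X] using this

theorem re_opTrace_mul_log_sum_smul_le [FiniteDimensional ℂ H] (hX : ∀ i ∈ s, 0 ≤ X i)
    (hL : IsSelfAdjoint L) (hXL : ∑ i ∈ s, X i ≤ NormedSpace.exp L) (hc : ∀ i ∈ s, 0 ≤ c i) :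
    (opTrace (cfc (fun x : ℝ => x * Real.log x) (∑ i ∈ s, c i • X i))).re ≤
      ∑ i ∈ s, c i * Real.log (c i) * (opTrace (X i)).re +
        (opTrace ((∑ i ∈ s, c i • X i) * L)).re := by
  set A := ∑ i ∈ s, c i • X i with hA_def
  have hA : 0 ≤ A := Finset.sum_nonneg fun i hi => smul_nonneg (hc i hi) (hX i hi)
  obtain ⟨b, a, ha, hb⟩ := exists_orthonormalBasis_apply_eq_smul hA
  have htrace : ∀ p : ℝ, (opTrace (A ^ p)).re = ∑ j, a j ^ p := fun p => by
    rw [CFC.rpow_eq_cfc_real hA, opTrace_cfc hA.isSelfAdjoint b hb, Complex.ofReal_re]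
  have hleft : HasDerivAt (fun p : ℝ => (opTrace (A ^ p)).re)
      (opTrace (cfc (fun x : ℝ => x * Real.log x) A)).re 1 := by
    simp only [htrace, opTrace_cfc hA.isSelfAdjoint b hb, Complex.ofReal_re]
    exact HasDerivAt.fun_sum fun j _ => hasDerivAt_rpow_exponent (ha j)
  have hright : HasDerivAt
      (fun p : ℝ => ∑ i ∈ s, c i ^ p * (opTrace (X i * NormedSpace.exp ((p - 1) • L))).re)
      (∑ i ∈ s, (c i * Real.log (c i) * (opTrace (X i)).re + c i * (opTrace (X i * L)).re)) 1 := by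
    refine HasDerivAt.fun_sum fun i hi => ?_
    simpa using (hasDerivAt_rpow_exponent (hc i hi)).fun_mul
      (hasDerivAt_re_opTrace_mul_exp_smul (X i) L)
  have hlinear : ∀ y, (opTrace (A * y)).re = ∑ i ∈ s, c i * (opTrace (X i * y)).re := fun y => by
    simp only [← reTraceMul_apply, hA_def, map_sum, map_smul, smul_eq_mul]
  have h := deriv_le_deriv_of_eq_of_forall_lt_le hleft hright
    (by simpa [CFC.rpow_one A hA] using hlinear 1) fun p hp =>
      re_opTrace_rpow_sum_smul_le hX hL hXL hc hp.le
  rwa [Finset.sum_add_distrib, ← hlinear] at h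

end TraceInequality

section SimpleApproximation

open Filter Topology

variable {Ω : Type*} [MeasurableSpace Ω] {μ : Measure Ω} {F : Type*} [NormedAddCommGroup F]
  [NormedSpace ℝ F] {k : Ω → ℝ}

theorem integral_comp_simpleFunc_smul (φ : SimpleFunc Ω ℝ) (f : ℝ → ℝ) {Y : Ω → F}
    (hY : Integrable Y μ) :
    ∫ ω, f (φ ω) • Y ω ∂μ = ∑ c ∈ φ.range, f c • ∫ ω in φ ⁻¹' {c}, Y ω ∂μ := by
  have hcover : ⋃ c ∈ φ.range, φ ⁻¹' {c} = Set.univ := by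
    ext ω
    simp
  have hfibre : ∀ c, Set.EqOn (fun ω => f (φ ω) • Y ω) (fun ω => f c • Y ω) (φ ⁻¹' {c}) :=
    fun c ω hω => by simp [Set.mem_singleton_iff.1 hω]
  rw [← setIntegral_univ, ← hcover, integral_biUnion_finset _ fun c _ => φ.measurableSet_fiber c]
  · refine Finset.sum_congr rfl fun c _ => ?_
    rw [setIntegral_congr_fun (φ.measurableSet_fiber c) (hfibre c), integral_smul]
  · exact fun c _ d _ hcd => Disjoint.preimage φ (Set.disjoint_singleton.2 hcd)
  · exact fun c _ => (integrableOn_congr_fun (hfibre c) (φ.measurableSet_fiber c)).2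
      (hY.integrableOn.smul (f c))

theorem sum_setIntegral_fiber (φ : SimpleFunc Ω ℝ) {Y : Ω → F} (hY : Integrable Y μ) :
    ∑ c ∈ φ.range, ∫ ω in φ ⁻¹' {c}, Y ω ∂μ = ∫ ω, Y ω ∂μ := by
  simpa only [one_smul] using (integral_comp_simpleFunc_smul φ (fun _ => 1) hY).symm

theorem exists_simpleFunc_tendsto (hkm : Measurable k) (hk0 : ∀ ω, 0 ≤ k ω) :
    ∃ φ : ℕ → SimpleFunc Ω ℝ, (∀ n ω, φ n ω ∈ Set.Icc 0 (k ω)) ∧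
      ∀ ω, Tendsto (fun n => φ n ω) atTop (𝓝 (k ω)) := by
  have hm : Measurable fun ω => ENNReal.ofReal (k ω) := hkm.ennreal_ofReal
  refine ⟨fun n => (SimpleFunc.eapprox (fun ω => ENNReal.ofReal (k ω)) n).map ENNReal.toReal,
    fun n ω => ⟨ENNReal.toReal_nonneg, ?_⟩, fun ω => ?_⟩
  · refine ENNReal.toReal_le_of_le_ofReal (hk0 ω) ?_
    rw [← SimpleFunc.iSup_eapprox_apply hm ω]
    exact le_iSup (fun n => SimpleFunc.eapprox (fun ω => ENNReal.ofReal (k ω)) n ω) n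
  · have := (ENNReal.tendsto_toReal ENNReal.ofReal_ne_top).comp
      (SimpleFunc.tendsto_eapprox hm ω)
    rwa [ENNReal.toReal_ofReal (hk0 ω)] at this

theorem le_integral_of_forall_simpleFunc_le (hkm : Measurable k) (hk0 : ∀ ω, 0 ≤ k ω) {Y : Ω → F}
    (hY : AEStronglyMeasurable Y μ) (hkY : Integrable (fun ω => k ω • Y ω) μ) {S : Set F}
    (hS : ∀ f : Ω → ℝ, (∀ ω, 0 ≤ f ω) → ∫ ω, f ω • Y ω ∂μ ∈ S) {Θ : F → ℝ} (hΘ : ContinuousOn Θ S)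
    {h : ℝ → ℝ} (hh : Continuous h) {w : Ω → ℝ} (hw : AEStronglyMeasurable w μ) {bound : Ω → ℝ}
    (hbound : Integrable bound μ) (hdom : ∀ ω, ∀ t ∈ Set.Icc 0 (k ω), |h t * w ω| ≤ bound ω)
    (hle : ∀ φ : SimpleFunc Ω ℝ, (∀ ω, 0 ≤ φ ω) →
      Θ (∫ ω, φ ω • Y ω ∂μ) ≤ ∫ ω, h (φ ω) * w ω ∂μ) :
    Θ (∫ ω, k ω • Y ω ∂μ) ≤ ∫ ω, h (k ω) * w ω ∂μ := by
  obtain ⟨φ, hφk, hφ⟩ := exists_simpleFunc_tendsto hkm hk0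
  have hleft : Tendsto (fun n => ∫ ω, φ n ω • Y ω ∂μ) atTop (𝓝 (∫ ω, k ω • Y ω ∂μ)) := by
    refine tendsto_integral_of_dominated_convergence (fun ω => ‖k ω • Y ω‖)
      (fun n => (φ n).aestronglyMeasurable.smul hY) hkY.norm
      (fun n => .of_forall fun ω => ?_) (.of_forall fun ω => (hφ ω).smul_const _)
    rw [norm_smul, norm_smul, Real.norm_of_nonneg (hφk n ω).1, Real.norm_of_nonneg (hk0 ω)]
    exact mul_le_mul_of_nonneg_right (hφk n ω).2 (norm_nonneg _)
  have hright : Tendsto (fun n => ∫ ω, h (φ n ω) * w ω ∂μ) atTop (𝓝 (∫ ω, h (k ω) * w ω ∂μ)) :=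
    tendsto_integral_of_dominated_convergence bound
      (fun n => (hh.comp_aestronglyMeasurable (φ n).aestronglyMeasurable).mul hw) hbound
      (fun n => .of_forall fun ω => hdom ω _ (hφk n ω))
      (.of_forall fun ω => ((hh.tendsto _).comp (hφ ω)).mul_const _)
  have hΘlim := (hΘ _ (hS k hk0)).tendsto.comp (tendsto_nhdsWithin_iff.2
    ⟨hleft, .of_forall fun n => hS _ fun ω => (hφk n ω).1⟩)
  exact le_of_tendsto_of_tendsto' hΘlim hright fun n => hle (φ n) fun ω => (hφk n ω).1

end SimpleApproximation

section IntegralInequality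

variable {H : Type*} [NormedAddCommGroup H] [InnerProductSpace ℂ H] [CompleteSpace H]
  [FiniteDimensional ℂ H]

theorem continuousOn_re_opTrace_cfc {f : ℝ → ℝ} (hf : Continuous f) :
    ContinuousOn (fun A : H →L[ℂ] H => (opTrace (cfc f A)).re) {A | 0 ≤ A} := by
  have hcfc : ContinuousOn (fun A : H →L[ℂ] H => cfc f A) {A | 0 ≤ A} :=
    continuousOn_id.cfc_of_mem_nhdsSet (s := Set.univ) f Filter.univ_mem
      (fun A hA => IsSelfAdjoint.of_nonneg hA) hf.continuousOn
  simp only [← reTraceMul_one]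
  exact (reTraceMul 1).continuous.comp_continuousOn hcfc

theorem abs_mul_log_le {s t : ℝ} (hs : 0 ≤ s) (hst : s ≤ t) :
    |s * Real.log s| ≤ 1 + |t * Real.log t| := by
  rcases hs.eq_or_lt with rfl | hs
  · simp only [zero_mul, abs_zero]
    positivity
  rcases le_total s 1 with h1 | h1
  · rw [mul_comm]
    exact (Real.abs_log_mul_self_lt s hs h1).le.trans (le_add_of_nonneg_right (abs_nonneg _))
  · rw [abs_of_nonneg (Real.mul_log_nonneg h1), abs_of_nonneg (Real.mul_log_nonneg (h1.trans hst))]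
    have : s * Real.log s ≤ t * Real.log t :=
      mul_le_mul hst (Real.log_le_log hs hst) (Real.log_nonneg h1) (hs.le.trans hst)
    linarith

variable {Ω : Type*} [MeasurableSpace Ω] {μ : Measure Ω} {X : Ω → H →L[ℂ] H} {L : H →L[ℂ] H}
  {k : Ω → ℝ}

theorem re_opTrace_rpow_integral_smul_le (hX : ∀ ω, 0 ≤ X ω) (hXi : Integrable X μ)
    (hL : IsSelfAdjoint L) (hXL : ∫ ω, X ω ∂μ ≤ NormedSpace.exp L) (hkm : Measurable k)
    (hk0 : ∀ ω, 0 ≤ k ω) (hkX : Integrable (fun ω => k ω • X ω) μ) {p : ℝ} (hp : 1 ≤ p)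
    (hkp : Integrable
      (fun ω => k ω ^ p * (opTrace (X ω * NormedSpace.exp ((p - 1) • L))).re) μ) :
    (opTrace ((∫ ω, k ω • X ω ∂μ) ^ p)).re ≤
      ∫ ω, k ω ^ p * (opTrace (X ω * NormedSpace.exp ((p - 1) • L))).re ∂μ := by
  have hp0 : 0 ≤ p := zero_le_one.trans hp
  have hpos : ∀ f : Ω → ℝ, (∀ ω, 0 ≤ f ω) → 0 ≤ ∫ ω, f ω • X ω ∂μ := fun f hf =>
    integral_nonneg fun ω => smul_nonneg (hf ω) (hX ω)
  set W := NormedSpace.exp ((p - 1) • L)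
  have hWi : Integrable (fun ω => (opTrace (X ω * W)).re) μ :=
    (reTraceMul W).integrable_comp hXi
  rw [CFC.rpow_eq_cfc_real (hpos k hk0)]
  refine le_integral_of_forall_simpleFunc_le hkm hk0 hXi.aestronglyMeasurable hkX hpos
    (continuousOn_re_opTrace_cfc (Real.continuous_rpow_const hp0))
    (Real.continuous_rpow_const hp0) hWi.aestronglyMeasurable hkp (fun ω t ht => ?_) fun φ hφ => ?_
  · have hw := re_opTrace_mul_exp_smul_nonneg (hX ω) hL (p - 1)
    rw [abs_of_nonneg (mul_nonneg (Real.rpow_nonneg ht.1 p) hw)]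
    exact mul_le_mul_of_nonneg_right (Real.rpow_le_rpow ht.1 ht.2 hp0) hw
  · have hA : ∫ ω, φ ω • X ω ∂μ = ∑ c ∈ φ.range, c • ∫ ω in φ ⁻¹' {c}, X ω ∂μ :=
      integral_comp_simpleFunc_smul φ id hXi
    have hM : ∫ ω, φ ω ^ p * (opTrace (X ω * W)).re ∂μ =
        ∑ c ∈ φ.range, c ^ p * (opTrace ((∫ ω in φ ⁻¹' {c}, X ω ∂μ) * W)).re := by
      simp only [← reTraceMul_apply, ← (reTraceMul W).integral_comp_comm hXi.integrableOn]
      exact integral_comp_simpleFunc_smul φ (· ^ p) hWi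
    rw [← CFC.rpow_eq_cfc_real (hpos φ hφ), hA, hM]
    exact re_opTrace_rpow_sum_smul_le (fun c _ => integral_nonneg hX) hL
      (sum_setIntegral_fiber φ hXi ▸ hXL) (φ.forall_mem_range.2 hφ) hp

theorem re_opTrace_mul_log_integral_smul_le (hX : ∀ ω, 0 ≤ X ω) (hXi : Integrable X μ)
    (hL : IsSelfAdjoint L) (hXL : ∫ ω, X ω ∂μ ≤ NormedSpace.exp L) (hkm : Measurable k)
    (hk0 : ∀ ω, 0 ≤ k ω) (hkX : Integrable (fun ω => k ω • X ω) μ)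
    (hkl : Integrable (fun ω => k ω * Real.log (k ω) * (opTrace (X ω)).re) μ) :
    (opTrace (cfc (fun x : ℝ => x * Real.log x) (∫ ω, k ω • X ω ∂μ))).re ≤
      ∫ ω, k ω * Real.log (k ω) * (opTrace (X ω)).re ∂μ +
        (opTrace ((∫ ω, k ω • X ω ∂μ) * L)).re := by
  have hXt : Integrable (fun ω => (opTrace (X ω)).re) μ := by
    simpa only [reTraceMul_one] using (reTraceMul 1).integrable_comp hXi
  rw [← sub_le_iff_le_add]
  refine le_integral_of_forall_simpleFunc_le hkm hk0 hXi.aestronglyMeasurable hkX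
    (S := {A | 0 ≤ A}) (Θ := fun A => (opTrace (cfc (fun x : ℝ => x * Real.log x) A)).re -
      reTraceMul L A) (h := fun t => t * Real.log t)
    (fun f hf => integral_nonneg fun ω => smul_nonneg (hf ω) (hX ω))
    ((continuousOn_re_opTrace_cfc Real.continuous_mul_log).sub
      (reTraceMul L).continuous.continuousOn)
    Real.continuous_mul_log hXt.aestronglyMeasurable (hXt.add hkl.abs)
    (fun ω t ht => ?_) fun φ hφ => ?_
  · simp only [Pi.add_apply, abs_mul _ (opTrace (X ω)).re, abs_of_nonneg (re_opTrace_nonneg (hX ω))]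
    rw [← one_add_mul]
    exact mul_le_mul_of_nonneg_right (abs_mul_log_le ht.1 ht.2)
      (re_opTrace_nonneg (hX ω))
  · have hA : ∫ ω, φ ω • X ω ∂μ = ∑ c ∈ φ.range, c • ∫ ω in φ ⁻¹' {c}, X ω ∂μ :=
      integral_comp_simpleFunc_smul φ id hXi
    have hM : ∫ ω, φ ω * Real.log (φ ω) * (opTrace (X ω)).re ∂μ =
        ∑ c ∈ φ.range, c * Real.log c * (opTrace (∫ ω in φ ⁻¹' {c}, X ω ∂μ)).re := by
      simp only [← reTraceMul_one, ← (reTraceMul 1).integral_comp_comm hXi.integrableOn]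
      exact integral_comp_simpleFunc_smul φ (fun t => t * Real.log t)
        ((reTraceMul 1).integrable_comp hXi)
    rw [hA, hM, sub_le_iff_le_add]
    exact re_opTrace_mul_log_sum_smul_le (fun c _ => integral_nonneg hX) hL
      (sum_setIntegral_fiber φ hXi ▸ hXL) (φ.forall_mem_range.2 hφ)

end IntegralInequality

section SpectralLog

variable {H : Type*} [NormedAddCommGroup H] [InnerProductSpace ℂ H] [CompleteSpace H]
  [FiniteDimensional ℂ H] {E : H →L[ℂ] H}

theorem mul_log_eq_cfc (hE : IsSelfAdjoint E) :
    E * CFC.log E = cfc (fun x : ℝ => x * Real.log x) E := by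
  have hcont := continuousOn_spectrum_real E
  rw [cfc_mul (fun x => x) _ E (hcont _) (hcont _), cfc_id' ℝ E, CFC.log]

theorem exp_smul_log_eq_cfc (hE : IsSelfAdjoint E) (r : ℝ) :
    NormedSpace.exp (r • CFC.log E) = cfc (fun x => Real.exp (r * Real.log x)) E := by
  have hcont := continuousOn_spectrum_real E Real.log
  rw [CFC.log, ← cfc_const_mul r _ E hcont,
    ← CFC.real_exp_eq_normedSpace_exp (cfc_predicate _ E),
    ← cfc_comp' Real.exp (fun x => r * Real.log x) E
      Real.continuous_exp.continuousOn (hcont.const_mul r)]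

-- Only an inequality: since `log 0 = 0`, the exponential is the identity on the kernel of `E`.
theorem le_exp_log (hE : IsSelfAdjoint E) : E ≤ NormedSpace.exp (CFC.log E) := by
  have hcont := continuousOn_spectrum_real E
  calc E = cfc (fun x : ℝ => x) E := (cfc_id' ℝ E).symm
    _ ≤ cfc (fun x => Real.exp (1 * Real.log x)) E :=
      cfc_mono (fun x _ => by simpa using Real.le_exp_log x) (hcont _) (hcont _)
    _ = NormedSpace.exp (CFC.log E) := by rw [← exp_smul_log_eq_cfc hE, one_smul]

theorem mul_exp_smul_log (hE : 0 ≤ E) {p : ℝ} (hp : p ≠ 0) :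
    E * NormedSpace.exp ((p - 1) • CFC.log E) = E ^ p := by
  have hcont := continuousOn_spectrum_real E
  rw [exp_smul_log_eq_cfc hE.isSelfAdjoint, CFC.rpow_eq_cfc_real hE]
  nth_rw 1 [← cfc_id' ℝ E]
  rw [← cfc_mul _ _ E (hcont _) (hcont _)]
  refine cfc_congr fun x hx => ?_
  rcases (spectrum_nonneg_of_nonneg hE hx).eq_or_lt with rfl | hx
  · simp [Real.zero_rpow hp]
  · simp only [mul_comm (p - 1), ← Real.rpow_def_of_pos hx]
    rw [Real.rpow_sub_one hx.ne', mul_div_cancel₀ _ hx.ne']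

end SpectralLog

section FixedAlgebra

variable {G : Type*} {H : Type*} [NormedAddCommGroup H] [InnerProductSpace ℂ H] [CompleteSpace H]
  {u : G → unitary (H →L[ℂ] H)} {L : H →L[ℂ] H}

theorem mem_fixedAlgebra_iff : L ∈ fixedAlgebra u ↔ ∀ g, Commute (u g : H →L[ℂ] H) L := by
  simp [fixedAlgebra, Subalgebra.mem_centralizer_iff, Commute, SemiconjBy]

theorem cfc_mem_fixedAlgebra (hL : L ∈ fixedAlgebra u) (f : ℝ → ℝ) : cfc f L ∈ fixedAlgebra u :=
  mem_fixedAlgebra_iff.2 fun g => ((mem_fixedAlgebra_iff.1 hL g).symm.cfc_real f).symm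

theorem rpow_mem_fixedAlgebra (hL : L ∈ fixedAlgebra u) (r : ℝ) : L ^ r ∈ fixedAlgebra u :=
  mem_fixedAlgebra_iff.2 fun g => ((mem_fixedAlgebra_iff.1 hL g).symm.cfc_nnreal _).symm

/-- The orbit `g ↦ u(g)^* x u(g)` of an operator under conjugation; `transferMap` and
`fixExpectation` are its weighted and unweighted means. -/
def conjOrbit (u : G → unitary (H →L[ℂ] H)) (x : H →L[ℂ] H) (g : G) : H →L[ℂ] H :=
  star (u g : H →L[ℂ] H) * x * (u g : H →L[ℂ] H)

theorem norm_conjOrbit (x : H →L[ℂ] H) (g : G) : ‖conjOrbit u x g‖ = ‖x‖ := by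
  rw [conjOrbit, CStarRing.norm_mul_coe_unitary, ← Unitary.coe_star,
    CStarRing.norm_coe_unitary_mul]

theorem conjOrbit_nonneg {x : H →L[ℂ] H} (hx : 0 ≤ x) (g : G) : 0 ≤ conjOrbit u x g :=
  star_left_conjugate_nonneg hx _

theorem conjOrbit_eq_self_iff {g : G} : conjOrbit u L g = L ↔ Commute (u g : H →L[ℂ] H) L :=
  (commute_unitary_iff_star_left_conjugate (u g).2).symm

theorem opTrace_conjOrbit_mul (x : H →L[ℂ] H) (hL : L ∈ fixedAlgebra u) (g : G) :
    opTrace (conjOrbit u x g * L) = opTrace (x * L) := by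
  have hug : (u g : H →L[ℂ] H) * star (u g : H →L[ℂ] H) = 1 := Unitary.mul_star_self_of_mem (u g).2
  rw [conjOrbit, mul_assoc, mul_assoc, opTrace_mul_comm, (mem_fixedAlgebra_iff.1 hL g).eq,
    mul_assoc, mul_assoc, hug, mul_one]

theorem conjOrbit_mul_mul (x : H →L[ℂ] H) (hL : L ∈ fixedAlgebra u) (g : G) :
    conjOrbit u (L * x * L) g = L * conjOrbit u x g * L := by
  have hu := mem_fixedAlgebra_iff.1 hL g
  have hstar : Commute (star (u g : H →L[ℂ] H)) L := by
    rw [commute_unitary_iff_star_left_conjugate (Unitary.star_mem (u g).2), star_star]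
    exact (commute_unitary_iff_star_right_conjugate (u g).2).1 hu
  simp only [conjOrbit, mul_assoc]
  rw [hstar.left_comm, hu.eq]

theorem conjOrbit_conjOrbit [Group G] [TopologicalSpace G] (hu : IsProjectiveRep u)
    (x : H →L[ℂ] H) (g h : G) : conjOrbit u (conjOrbit u x g) h = conjOrbit u x (g * h) := by
  obtain ⟨c, hc, hgh⟩ := hu.mul_phase g h
  have hcc : star c * c = 1 := by
    rw [RCLike.star_def, Complex.conj_mul', hc, Complex.ofReal_one, one_pow]
  calc conjOrbit u (conjOrbit u x g) h
      = star ((u g : H →L[ℂ] H) * (u h : H →L[ℂ] H)) * x *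
          ((u g : H →L[ℂ] H) * (u h : H →L[ℂ] H)) := by
        simp only [conjOrbit, star_mul, mul_assoc]
    _ = conjOrbit u x (g * h) := by
        rw [hgh, star_smul, smul_mul_assoc, smul_mul_assoc, mul_smul_comm, smul_smul, hcc, one_smul,
          conjOrbit]

end FixedAlgebra

section Transfer

open scoped InnerProductSpace

variable {G : Type*} [MeasurableSpace G] {μ : Measure G} {H : Type*} [NormedAddCommGroup H]
  [InnerProductSpace ℂ H] [CompleteSpace H] {u : G → unitary (H →L[ℂ] H)} {k : G → ℝ}
  {ρ σ L : H →L[ℂ] H}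

theorem transferMap_eq_integral_smul (x : H →L[ℂ] H) :
    transferMap μ u k x = ∫ g, k g • conjOrbit u x g ∂μ := by
  simp only [transferMap, Complex.coe_smul, conjOrbit]

theorem fixExpectation_eq_transferMap (x : H →L[ℂ] H) :
    fixExpectation μ u x = transferMap μ u (fun _ => 1) x := by
  simp only [transferMap, fixExpectation, Complex.ofReal_one, one_smul]

theorem transferMap_nonneg (hk0 : ∀ g, 0 ≤ k g) (hρ : 0 ≤ ρ) : 0 ≤ transferMap μ u k ρ :=
  transferMap_eq_integral_smul (μ := μ) ρ ▸
    integral_nonneg fun g => smul_nonneg (hk0 g) (conjOrbit_nonneg hρ g)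

theorem fixExpectation_nonneg (hρ : 0 ≤ ρ) : 0 ≤ fixExpectation μ u ρ :=
  integral_nonneg fun g => conjOrbit_nonneg hρ g

theorem weighted_nonneg (q : ℝ≥0∞) (hρ : 0 ≤ ρ) : 0 ≤ weighted q σ ρ := by
  have h : 0 ≤ σ ^ (-(q⁻¹.toReal / 2)) := CFC.rpow_nonneg
  simpa only [weighted, h.isSelfAdjoint.star_eq] using
    star_left_conjugate_nonneg hρ (σ ^ (-(q⁻¹.toReal / 2)))

variable [Group G] [TopologicalSpace G] [OpensMeasurableSpace G] [FiniteDimensional ℂ H]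

theorem integrable_smul_conjOrbit (hu : IsProjectiveRep u) (hk : Integrable k μ)
    (x : H →L[ℂ] H) : Integrable (fun g => k g • conjOrbit u x g) μ :=
  hk.smul_bdd ‖x‖ (hu.continuous_conj x).aestronglyMeasurable
    (.of_forall fun g => (norm_conjOrbit x g).le)

theorem integrable_conjOrbit [IsFiniteMeasure μ] (hu : IsProjectiveRep u) (x : H →L[ℂ] H) :
    Integrable (conjOrbit u x) μ := by
  simpa only [one_smul] using integrable_smul_conjOrbit hu (integrable_const (1 : ℝ)) x

theorem transferMap_mul_mul (hu : IsProjectiveRep u) (hk : Integrable k μ) (x : H →L[ℂ] H)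
    (hL : L ∈ fixedAlgebra u) :
    transferMap μ u k (L * x * L) = L * transferMap μ u k x * L := by
  have h := ContinuousLinearMap.integral_comp_comm
    (ContinuousLinearMap.mulLeftRight ℝ (H →L[ℂ] H) L L) (integrable_smul_conjOrbit hu hk x)
  simpa only [transferMap_eq_integral_smul, conjOrbit_mul_mul x hL, map_smul,
    ContinuousLinearMap.mulLeftRight_apply] using h

theorem weighted_transferMap (hu : IsProjectiveRep u) (hk : Integrable k μ) (q : ℝ≥0∞)
    (hσ : σ ∈ fixedAlgebra u) (x : H →L[ℂ] H) :
    weighted q σ (transferMap μ u k x) = transferMap μ u k (weighted q σ x) :=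
  (transferMap_mul_mul hu hk x (rpow_mem_fixedAlgebra hσ _)).symm

theorem weighted_fixExpectation [IsFiniteMeasure μ] (hu : IsProjectiveRep u) (q : ℝ≥0∞)
    (hσ : σ ∈ fixedAlgebra u) (x : H →L[ℂ] H) :
    weighted q σ (fixExpectation μ u x) = fixExpectation μ u (weighted q σ x) := by
  simp only [fixExpectation_eq_transferMap]
  exact weighted_transferMap hu (integrable_const 1) q hσ x

theorem re_opTrace_transferMap_mul (hu : IsProjectiveRep u) (hk : Integrable k μ)
    (x : H →L[ℂ] H) (hL : L ∈ fixedAlgebra u) :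
    (opTrace (transferMap μ u k x * L)).re = (∫ g, k g ∂μ) * (opTrace (x * L)).re := by
  rw [transferMap_eq_integral_smul, ← reTraceMul_apply,
    ← (reTraceMul L).integral_comp_comm (integrable_smul_conjOrbit hu hk x), ← integral_mul_const]
  simp only [map_smul, reTraceMul_apply, opTrace_conjOrbit_mul x hL, smul_eq_mul]

theorem re_opTrace_fixExpectation_mul [IsProbabilityMeasure μ] (hu : IsProjectiveRep u)
    (x : H →L[ℂ] H) (hL : L ∈ fixedAlgebra u) :
    (opTrace (fixExpectation μ u x * L)).re = (opTrace (x * L)).re := by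
  rw [fixExpectation_eq_transferMap, re_opTrace_transferMap_mul hu (integrable_const 1) x hL,
    integral_const, probReal_univ, one_smul, one_mul]

theorem fixExpectation_mem_fixedAlgebra [MeasurableMul G] [μ.IsMulRightInvariant]
    [IsFiniteMeasure μ] (hu : IsProjectiveRep u) (x : H →L[ℂ] H) :
    fixExpectation μ u x ∈ fixedAlgebra u := by
  refine mem_fixedAlgebra_iff.2 fun h => conjOrbit_eq_self_iff.1 ?_
  calc conjOrbit u (fixExpectation μ u x) h
      = ∫ g, conjOrbit u (conjOrbit u x g) h ∂μ :=
        (ContinuousLinearMap.integral_comp_comm (ContinuousLinearMap.mulLeftRight ℂ _ _ _)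
          (integrable_conjOrbit hu x)).symm
    _ = ∫ g, conjOrbit u x (g * h) ∂μ := by simp only [conjOrbit_conjOrbit hu]
    _ = fixExpectation μ u x := integral_mul_right_eq_self _ h

theorem fixExpectation_ne_zero [IsProbabilityMeasure μ] (hu : IsProjectiveRep u) (hρ : 0 ≤ ρ)
    (hρ0 : ρ ≠ 0) : fixExpectation μ u ρ ≠ 0 := by
  intro h
  refine hρ0 (eq_zero_of_re_opTrace_eq_zero hρ ?_)
  have htr := re_opTrace_fixExpectation_mul (μ := μ) hu ρ (one_mem (fixedAlgebra u))
  rw [h, zero_mul, mul_one] at htr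
  rw [← htr, opTrace]
  simp

theorem transferMap_le_smul_fixExpectation [IsFiniteMeasure μ] (hu : IsProjectiveRep u)
    (hk : Integrable k μ) (hρ : 0 ≤ ρ) {C : ℝ} (hC : ∀ᵐ g ∂μ, k g ≤ C) :
    transferMap μ u k ρ ≤ C • fixExpectation μ u ρ := by
  rw [transferMap_eq_integral_smul, fixExpectation, ← integral_smul]
  refine integral_mono_ae (integrable_smul_conjOrbit hu hk ρ)
    ((integrable_conjOrbit hu ρ).smul C) ?_
  filter_upwards [hC] with g hg
  exact smul_le_smul_of_nonneg_right hg (conjOrbit_nonneg hρ g)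

theorem transferMap_apply_eq_zero [IsFiniteMeasure μ] (hu : IsProjectiveRep u)
    (hk : Integrable k μ) (hρ : 0 ≤ ρ) {v : H} (hv : fixExpectation μ u ρ v = 0) :
    transferMap μ u k ρ v = 0 := by
  have hint : Integrable (fun g => conjOrbit u ρ g v) μ :=
    (integrable_conjOrbit hu ρ).apply_continuousLinearMap v
  have hinner : Integrable (fun g => ⟪v, conjOrbit u ρ g v⟫_ℂ) μ := hint.const_inner v
  have hnonneg : ∀ g, 0 ≤ (⟪v, conjOrbit u ρ g v⟫_ℂ).re := fun g => by
    simpa using re_inner_apply_mono (conjOrbit_nonneg hρ g) v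
  have hzero : ∫ g, (⟪v, conjOrbit u ρ g v⟫_ℂ).re ∂μ = 0 := by
    calc ∫ g, (⟪v, conjOrbit u ρ g v⟫_ℂ).re ∂μ = (∫ g, ⟪v, conjOrbit u ρ g v⟫_ℂ ∂μ).re :=
          integral_re hinner
      _ = (⟪v, fixExpectation μ u ρ v⟫_ℂ).re := by
          rw [integral_inner hint]
          exact congrArg (fun w => (⟪v, w⟫_ℂ).re)
            (ContinuousLinearMap.integral_apply (integrable_conjOrbit hu ρ) v).symm
      _ = 0 := by rw [hv, inner_zero_right, Complex.zero_re]
  have hae := (integral_eq_zero_iff_of_nonneg hnonneg hinner.re).1 hzero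
  rw [transferMap_eq_integral_smul,
    ContinuousLinearMap.integral_apply (integrable_smul_conjOrbit hu hk ρ)]
  refine integral_eq_zero_of_ae ?_
  filter_upwards [hae] with g hg
  simp [apply_eq_zero_of_re_inner_eq_zero (conjOrbit_nonneg hρ g) hg]

end Transfer

section TraceBounds

variable {G : Type*} [Group G] [TopologicalSpace G] [MeasurableSpace G] [OpensMeasurableSpace G]
  [MeasurableMul G] {μ : Measure G} [μ.IsMulRightInvariant] [IsProbabilityMeasure μ]
  {H : Type*} [NormedAddCommGroup H] [InnerProductSpace ℂ H] [CompleteSpace H]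
  [FiniteDimensional ℂ H] {u : G → unitary (H →L[ℂ] H)} {k : G → ℝ} {ρ : H →L[ℂ] H}

theorem re_opTrace_rpow_transferMap_le (hu : IsProjectiveRep u) (hkm : Measurable k)
    (hk0 : ∀ g, 0 ≤ k g) (hk : Integrable k μ) (hρ : 0 ≤ ρ) {p : ℝ} (hp : 1 ≤ p)
    (hkp : Integrable (fun g => k g ^ p) μ) :
    (opTrace (transferMap μ u k ρ ^ p)).re ≤
      (∫ g, k g ^ p ∂μ) * (opTrace (fixExpectation μ u ρ ^ p)).re := by
  have hE : 0 ≤ fixExpectation μ u ρ := fixExpectation_nonneg hρ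
  have hW : NormedSpace.exp ((p - 1) • CFC.log (fixExpectation μ u ρ)) ∈ fixedAlgebra u := by
    rw [exp_smul_log_eq_cfc hE.isSelfAdjoint]
    exact cfc_mem_fixedAlgebra (fixExpectation_mem_fixedAlgebra hu ρ) _
  have htrace : ∀ g, (opTrace (conjOrbit u ρ g *
      NormedSpace.exp ((p - 1) • CFC.log (fixExpectation μ u ρ)))).re =
        (opTrace (fixExpectation μ u ρ ^ p)).re := fun g => by
    rw [opTrace_conjOrbit_mul ρ hW, ← re_opTrace_fixExpectation_mul (μ := μ) hu ρ hW,
      mul_exp_smul_log hE (by positivity)]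
  have h := re_opTrace_rpow_integral_smul_le (L := CFC.log (fixExpectation μ u ρ))
    (conjOrbit_nonneg hρ) (integrable_conjOrbit hu ρ) (cfc_predicate _ _)
    (le_exp_log hE.isSelfAdjoint) hkm hk0 (integrable_smul_conjOrbit hu hk ρ) hp
    (by simpa only [htrace] using hkp.mul_const _)
  simpa only [htrace, integral_mul_const, ← transferMap_eq_integral_smul] using h

theorem re_opTrace_transferMap_mul_log_le (hu : IsProjectiveRep u) (hkm : Measurable k)
    (hk0 : ∀ g, 0 ≤ k g) (hk : Integrable k μ) (hρ : 0 ≤ ρ)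
    (hkl : Integrable (fun g => k g * Real.log (k g)) μ) :
    (opTrace (transferMap μ u k ρ * CFC.log (transferMap μ u k ρ))).re ≤
      (∫ g, k g * Real.log (k g) ∂μ) * (opTrace ρ).re +
        (∫ g, k g ∂μ) * (opTrace (fixExpectation μ u ρ * CFC.log (fixExpectation μ u ρ))).re := by
  have hE : 0 ≤ fixExpectation μ u ρ := fixExpectation_nonneg hρ
  have hL : CFC.log (fixExpectation μ u ρ) ∈ fixedAlgebra u :=
    cfc_mem_fixedAlgebra (fixExpectation_mem_fixedAlgebra hu ρ) Real.log
  have htrace : ∀ g, (opTrace (conjOrbit u ρ g)).re = (opTrace ρ).re := fun g => by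
    simpa only [mul_one] using
      congrArg Complex.re (opTrace_conjOrbit_mul ρ (one_mem (fixedAlgebra u)) g)
  have h := re_opTrace_mul_log_integral_smul_le (L := CFC.log (fixExpectation μ u ρ))
    (conjOrbit_nonneg hρ) (integrable_conjOrbit hu ρ) (cfc_predicate _ _)
    (le_exp_log hE.isSelfAdjoint) hkm hk0 (integrable_smul_conjOrbit hu hk ρ)
    (by simpa only [htrace] using hkl.mul_const _)
  simp only [htrace, integral_mul_const, ← transferMap_eq_integral_smul] at h
  rwa [← mul_log_eq_cfc (transferMap_nonneg hk0 hρ).isSelfAdjoint,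
    re_opTrace_transferMap_mul hu hk ρ hL, ← re_opTrace_fixExpectation_mul (μ := μ) hu ρ hL] at h

end TraceBounds

section SchattenNorm

variable {H : Type*} [NormedAddCommGroup H] [InnerProductSpace ℂ H] [CompleteSpace H]
  {A : H →L[ℂ] H} {p : ℝ≥0∞}

theorem schattenNorm_of_nonneg (hA : 0 ≤ A) (hp : p ≠ ∞) :
    schattenNorm p A = (opTrace (A ^ p.toReal)).re ^ (1 / p.toReal) := by
  rw [schattenNorm, if_neg hp, CFC.abs_of_nonneg A hA]

theorem rpow_eq_zero_iff (hA : 0 ≤ A) {r : ℝ} (hr : 0 < r) : A ^ r = 0 ↔ A = 0 := by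
  have hzero : ∀ {s : ℝ}, s ≠ 0 → (0 : H →L[ℂ] H) ^ s = 0 := CFC.zero_rpow
  refine ⟨fun h => ?_, fun h => by rw [h, hzero hr.ne']⟩
  rw [← CFC.rpow_one A, ← mul_inv_cancel₀ hr.ne',
    ← CFC.rpow_rpow_of_exponent_nonneg A r r⁻¹ hr.le (inv_nonneg.2 hr.le), h,
    hzero (inv_pos.2 hr).ne']

theorem schattenNorm_zero (hp : p ≠ 0) : schattenNorm p (0 : H →L[ℂ] H) = 0 := by
  by_cases hp_top : p = ∞
  · simp [schattenNorm, hp_top]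
  · have hp0 := ENNReal.toReal_pos hp hp_top
    rw [schattenNorm_of_nonneg le_rfl hp_top, (rpow_eq_zero_iff le_rfl hp0).2 rfl]
    simp [opTrace, hp0.ne']

theorem schattenNorm_pos [FiniteDimensional ℂ H] (hA : 0 ≤ A) (hA0 : A ≠ 0) (hp : p ≠ 0) :
    0 < schattenNorm p A := by
  by_cases hp_top : p = ∞
  · simpa [schattenNorm, hp_top] using hA0
  · have hpow : 0 ≤ A ^ p.toReal := CFC.rpow_nonneg
    rw [schattenNorm_of_nonneg hA hp_top]
    refine Real.rpow_pos_of_pos ((re_opTrace_nonneg hpow).lt_of_ne' fun h => hA0 ?_) _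
    exact (rpow_eq_zero_iff hA (ENNReal.toReal_pos hp hp_top)).1
      (eq_zero_of_re_opTrace_eq_zero hpow h)

end SchattenNorm

section TransferBounds

variable {G : Type*} [Group G] [TopologicalSpace G] [MeasurableSpace G] [OpensMeasurableSpace G]
  {μ : Measure G} [IsProbabilityMeasure μ] {H : Type*} [NormedAddCommGroup H]
  [InnerProductSpace ℂ H] [CompleteSpace H] [FiniteDimensional ℂ H]
  {u : G → unitary (H →L[ℂ] H)} {k : G → ℝ} {ρ : H →L[ℂ] H}

theorem norm_transferMap_le (hu : IsProjectiveRep u) (hk0 : ∀ g, 0 ≤ k g) (hk : MemLp k ∞ μ)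
    (hρ : 0 ≤ ρ) :
    ‖transferMap μ u k ρ‖ ≤ (eLpNorm k ∞ μ).toReal * ‖fixExpectation μ u ρ‖ := by
  have hbound : ∀ᵐ g ∂μ, k g ≤ (eLpNorm k ∞ μ).toReal := by
    filter_upwards [ae_le_eLpNormEssSup (f := k) (μ := μ)] with g hg
    rw [← eLpNorm_exponent_top] at hg
    exact (Real.le_norm_self _).trans
      (toReal_enorm (k g) ▸ ENNReal.toReal_mono hk.eLpNorm_ne_top hg)
  simpa only [norm_smul, Real.norm_of_nonneg ENNReal.toReal_nonneg] using
    CStarAlgebra.norm_le_norm_of_nonneg_of_le (transferMap_nonneg hk0 hρ)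
      (transferMap_le_smul_fixExpectation hu (hk.integrable le_top) hρ hbound)

variable [MeasurableMul G] [μ.IsMulRightInvariant]

theorem schattenNorm_transferMap_le_of_memLp (hu : IsProjectiveRep u) (hkm : Measurable k)
    (hk0 : ∀ g, 0 ≤ k g) (hρ : 0 ≤ ρ) {p : ℝ≥0∞} (hp : 1 ≤ p) (hp_top : p ≠ ∞)
    (hk : MemLp k p μ) :
    schattenNorm p (transferMap μ u k ρ) ≤
      (eLpNorm k p μ).toReal * schattenNorm p (fixExpectation μ u ρ) := by
  have hp1 : 1 ≤ p.toReal := by simpa using ENNReal.toReal_mono hp_top hp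
  have hp0 : p ≠ 0 := (one_pos.trans_le hp).ne'
  have hA : 0 ≤ transferMap μ u k ρ := transferMap_nonneg hk0 hρ
  have hE : 0 ≤ fixExpectation μ u ρ := fixExpectation_nonneg hρ
  have hpow_nonneg : ∀ A : H →L[ℂ] H, 0 ≤ (opTrace (A ^ p.toReal)).re := fun A =>
    re_opTrace_nonneg CFC.rpow_nonneg
  have hkp0 : 0 ≤ ∫ g, k g ^ p.toReal ∂μ := integral_nonneg fun g => Real.rpow_nonneg (hk0 g) _
  have hnorm : ∀ g, ‖k g‖ = k g := fun g => Real.norm_of_nonneg (hk0 g)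
  have hkp := hk.integrable_norm_rpow hp0 hp_top
  have heLp := hk.eLpNorm_eq_integral_rpow_norm hp0 hp_top
  simp only [hnorm] at hkp heLp
  rw [schattenNorm_of_nonneg hA hp_top, schattenNorm_of_nonneg hE hp_top, heLp,
    ENNReal.toReal_ofReal (Real.rpow_nonneg hkp0 _), ← one_div,
    ← Real.mul_rpow hkp0 (hpow_nonneg _)]
  exact Real.rpow_le_rpow (hpow_nonneg _)
    (re_opTrace_rpow_transferMap_le hu hkm hk0 (hk.integrable hp) hρ hp1 hkp) (by positivity)

theorem schattenNorm_transferMap_le (hu : IsProjectiveRep u) (hkm : Measurable k)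
    (hk0 : ∀ g, 0 ≤ k g) (hρ : 0 ≤ ρ) {p : ℝ≥0∞} (hp : 1 ≤ p) :
    ENNReal.ofReal (schattenNorm p (transferMap μ u k ρ)) ≤
      eLpNorm k p μ * ENNReal.ofReal (schattenNorm p (fixExpectation μ u ρ)) := by
  have hp0 : p ≠ 0 := (one_pos.trans_le hp).ne'
  by_cases hρ0 : ρ = 0
  · simp [hρ0, transferMap, schattenNorm_zero hp0]
  by_cases htop : eLpNorm k p μ = ∞
  · have hpos := schattenNorm_pos (fixExpectation_nonneg (μ := μ) hρ)
      (fixExpectation_ne_zero (μ := μ) hu hρ hρ0) hp0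
    rw [htop, ENNReal.top_mul (ENNReal.ofReal_pos.2 hpos).ne']
    exact le_top
  · rw [← ENNReal.ofReal_toReal htop, ← ENNReal.ofReal_mul ENNReal.toReal_nonneg]
    have hmem : MemLp k p μ := ⟨hkm.aestronglyMeasurable, lt_top_iff_ne_top.2 htop⟩
    refine ENNReal.ofReal_le_ofReal ?_
    by_cases hp_top : p = ∞
    · subst hp_top
      simpa only [schattenNorm, if_true] using norm_transferMap_le hu hk0 hmem hρ
    · exact schattenNorm_transferMap_le_of_memLp hu hkm hk0 hρ hp hp_top hmem

theorem re_opTrace_mul_log_sub_log_transferMap_le (hu : IsProjectiveRep u) (hkm : Measurable k)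
    (hk0 : ∀ g, 0 ≤ k g) (hk1 : ∫ g, k g ∂μ = 1)
    (hkl : Integrable (fun g => k g * Real.log (k g)) μ) (hρ : IsState ρ) {L : H →L[ℂ] H}
    (hL : L ∈ fixedAlgebra u) :
    (opTrace (transferMap μ u k ρ * (CFC.log (transferMap μ u k ρ) - L))).re ≤
      (opTrace (fixExpectation μ u ρ * (CFC.log (fixExpectation μ u ρ) - L))).re +
        ∫ g, k g * Real.log (k g) ∂μ := by
  have hk : Integrable k μ := integrable_of_integral_eq_one hk1
  have hlog := re_opTrace_transferMap_mul_log_le hu hkm hk0 hk hρ.1 hkl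
  have htransfer := re_opTrace_transferMap_mul hu hk ρ hL
  rw [← re_opTrace_fixExpectation_mul (μ := μ) hu ρ hL] at htransfer
  simp only [hk1, hρ.2, Complex.one_re, one_mul, mul_one, ← reTraceMul_one] at hlog htransfer ⊢
  simp only [mul_sub, map_sub]
  linarith

theorem relEntropy_transferMap_le (hu : IsProjectiveRep u) (hkm : Measurable k)
    (hk0 : ∀ g, 0 ≤ k g) (hk1 : ∫ g, k g ∂μ = 1) (hρ : IsState ρ) {σ : H →L[ℂ] H}
    (hσ : σ ∈ fixedAlgebra u) :
    relEntropy (transferMap μ u k ρ) σ ≤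
      relEntropy (fixExpectation μ u ρ) σ + entropyIntegral μ k := by
  have hk : Integrable k μ := integrable_of_integral_eq_one hk1
  by_cases hker : (σ : H →ₗ[ℂ] H).ker ≤ (fixExpectation μ u ρ : H →ₗ[ℂ] H).ker
  · have hker_transfer : (σ : H →ₗ[ℂ] H).ker ≤ (transferMap μ u k ρ : H →ₗ[ℂ] H).ker :=
      fun v hv => transferMap_apply_eq_zero hu hk hρ.1 (hker hv)
    rw [relEntropy, relEntropy, if_pos hker, if_pos hker_transfer, entropyIntegral]
    split_ifs with hkl
    · exact_mod_cast re_opTrace_mul_log_sub_log_transferMap_le hu hkm hk0 hk1 hkl hρ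
        (cfc_mem_fixedAlgebra hσ Real.log)
    · rw [EReal.coe_add_top]
      exact le_top
  · have hbot : entropyIntegral μ k ≠ ⊥ := by
      rw [entropyIntegral]
      split_ifs
      · exact EReal.coe_ne_bot _
      · exact top_ne_bot
    rw [relEntropy, relEntropy, if_neg hker, EReal.top_add_of_ne_bot hbot]
    exact le_top

end TransferBounds

theorem isMulRightInvariant_of_compactSpace {G : Type*} [Group G] [TopologicalSpace G]
    [IsTopologicalGroup G] [CompactSpace G] [MeasurableSpace G] [BorelSpace G] (μ : Measure G)
    [μ.IsHaarMeasure] [IsProbabilityMeasure μ] : μ.IsMulRightInvariant := by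
  refine ⟨fun h => ?_⟩
  have : IsProbabilityMeasure (μ.map (· * h)) :=
    Measure.isProbabilityMeasure_map (measurable_mul_const h).aemeasurable
  exact Measure.isHaarMeasure_eq_of_isProbabilityMeasure _ _

end Transference

end

open Transference in
theorem mainTheorem1_general {G : Type*} [Group G] [TopologicalSpace G] [MeasurableSpace G]
    [OpensMeasurableSpace G] [MeasurableMul G] (μ : Measure G) [μ.IsMulRightInvariant]
    [IsProbabilityMeasure μ] {H : Type*} [NormedAddCommGroup H] [InnerProductSpace ℂ H]
    [CompleteSpace H] [FiniteDimensional ℂ H] (u : G → unitary (H →L[ℂ] H))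
    (hu : IsProjectiveRep u) (k : G → ℝ) (hk_meas : Measurable k) (hk_nonneg : ∀ g, 0 ≤ k g)
    (hk_int : ∫ g, k g ∂μ = 1) :
    (∀ σ : H →L[ℂ] H, σ ∈ fixedAlgebra u → 0 ≤ σ → ∀ ρ : H →L[ℂ] H, 0 ≤ ρ →
      ∀ p q : ℝ≥0∞, 1 ≤ p →
        ENNReal.ofReal (schattenNorm p (weighted q σ (transferMap μ u k ρ))) ≤
          eLpNorm k p μ *
            ENNReal.ofReal (schattenNorm p (weighted q σ (fixExpectation μ u ρ)))) ∧
    (∀ σ : H →L[ℂ] H, σ ∈ fixedAlgebra u → 0 ≤ σ → ∀ ρ : H →L[ℂ] H, IsState ρ →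
      relEntropy (transferMap μ u k ρ) σ ≤
        relEntropy (fixExpectation μ u ρ) σ + entropyIntegral μ k) := by
  refine ⟨fun σ hσ _ ρ hρ p q hp => ?_, fun σ hσ _ ρ hρ =>
    relEntropy_transferMap_le hu hk_meas hk_nonneg hk_int hρ hσ⟩
  rw [weighted_transferMap hu (integrable_of_integral_eq_one hk_int) q hσ,
    weighted_fixExpectation hu q hσ]
  exact schattenNorm_transferMap_le hu hk_meas hk_nonneg (weighted_nonneg q hρ) hp

theorem mainTheorem1
    {G : Type*} [Group G] [TopologicalSpace G] [IsTopologicalGroup G] [CompactSpace G] [T2Space G]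
    [MeasurableSpace G] [BorelSpace G]
    (μ : Measure G) [μ.IsHaarMeasure] [μ.Regular] [IsProbabilityMeasure μ]
    {H : Type*} [NormedAddCommGroup H] [InnerProductSpace ℂ H] [CompleteSpace H]
    [FiniteDimensional ℂ H]
    (u : G → unitary (H →L[ℂ] H)) (hu : Transference.IsProjectiveRep u)
    (k : G → ℝ) (hk_meas : Measurable k) (hk_nonneg : ∀ g, 0 ≤ k g) (hk_int : ∫ g, k g ∂μ = 1) :
    (∀ σ : H →L[ℂ] H, σ ∈ Transference.fixedAlgebra u → 0 ≤ σ →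
      ∀ ρ : H →L[ℂ] H, 0 ≤ ρ →
      ∀ p q : ℝ≥0∞, ENNReal.HolderConjugate p q →
        ENNReal.ofReal (Transference.schattenNorm p
            (Transference.weighted q σ (Transference.transferMap μ u k ρ))) ≤
          eLpNorm k p μ *
            ENNReal.ofReal (Transference.schattenNorm p
              (Transference.weighted q σ (Transference.fixExpectation μ u ρ)))) ∧
    (∀ σ : H →L[ℂ] H, σ ∈ Transference.fixedAlgebra u → Transference.IsState σ →
      ∀ ρ : H →L[ℂ] H, Transference.IsState ρ →
        Transference.relEntropy (Transference.transferMap μ u k ρ) σ ≤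
          Transference.relEntropy (Transference.fixExpectation μ u ρ) σ +
            Transference.entropyIntegral μ k) := by
  have := Transference.isMulRightInvariant_of_compactSpace μ
  have h := mainTheorem1_general μ u hu k hk_meas hk_nonneg hk_int
  exact ⟨fun σ hσ hσ0 ρ hρ p q hpq => h.1 σ hσ hσ0 ρ hρ p q (ENNReal.HolderConjugate.one_le p q),
    fun σ hσ hσ0 => h.2 σ hσ hσ0.1⟩
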